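/- Let $W$ be a Coxeter group with a fixed generating set of simple reflections, equipped with the Bruhat order (the reflexive and transitive closure of the relations $u<ut$, where $t$ is a conjugate of a generator and $\ell(u)<\ell(ut)$), and for $w\in W$ let $W^{\leq w}=\{u\in W: u\leq w\}$ be the Bruhat interval $[1,w]$. Let $a$ be a generator of $W$ and let $\overline w\in W$ be such that $a\not\leq\overline w$. Let $k$ be a field. If an abelian group $H$ acts on a $k$-algebra $A$ by $k$-algebra automorphisms, an $H$-prime ideal of $A$ is a proper $H$-stable two-sided ideal $P$ such that, for all $H$-stable two-sided ideals $I,J$ of $A$, $IJ\subseteq P$ implies $I\subseteq P$ or $J\subseteq P$; let $\operatorname{Spec}_H A$ be the set of $H$-prime ideals of $A$, partially ordered by inclusion. An Ore extension $S=R[x;\tau,\delta]$ of a (left and right) noetherian $k$-algebra $R$, with $\tau$ a $k$-algebra automorphism and $\delta$ a $k$-linear $\tau$-derivation (so that $xr=\tau(r)x+\delta(r)$ for $r\in R$), is called a Cauchon extension with respect to $q\in k^\times$ and $H$ if: (i) $\delta$ is locally nilpotent; (ii) $\delta\tau=q\tau\delta$ and $q$ is not a root of unity; (iii) $H$ is an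 abelian group acting on $S$ by $k$-algebra automorphisms; (iv) $R$ is $H$-stable and $x$ is an $H$-eigenvector; (v) there is $h_0\in H$ with $h_0|_R=\tau$ such that the $h_0$-eigenvalue of $x$ is not a root of unity; (vi) every $H$-prime ideal of $R$ is completely prime. Suppose that $S=R[x;\tau]=R[x;\tau,0]$ is a Cauchon extension of $R$ with zero derivation, and that $W^{\leq\overline w}\cong\operatorname{Spec}_H R$ as partially ordered sets. Then $W^{\leq\overline w a}\cong\operatorname{Spec}_H S$ as partially ordered sets. -/

import Mathlib

/-! ### The Bruhat order on a Coxeter group -/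

/-- An elementary Bruhat step `u < u t`, where `t` is a reflection (a conjugate of a generator) and
the length of `u t` is larger than the length of `u`. -/
def BruhatStep {B W : Type*} [Group W] {M : CoxeterMatrix B} (cs : CoxeterSystem M W)
    (u v : W) : Prop :=
  ∃ t : W, cs.IsReflection t ∧ v = u * t ∧ cs.length u < cs.length v

/-- The Bruhat order: the reflexive and transitive closure of the elementary steps. -/
def BruhatLE {B W : Type*} [Group W] {M : CoxeterMatrix B} (cs : CoxeterSystem M W)
    (u v : W) : Prop :=
  Relation.ReflTransGen (BruhatStep cs) u v

theorem BruhatLE.eq_or_length_lt {B W : Type*} [Group W] {M : CoxeterMatrix B}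
    {cs : CoxeterSystem M W} {u v : W} (h : BruhatLE cs u v) :
    u = v ∨ cs.length u < cs.length v := by
  induction h with
  | refl => exact Or.inl rfl
  | tail _ hs ih =>
    obtain ⟨t, -, -, hlt⟩ := hs
    rcases ih with rfl | ih
    · exact Or.inr hlt
    · exact Or.inr (ih.trans hlt)

theorem BruhatLE.antisymm {B W : Type*} [Group W] {M : CoxeterMatrix B}
    {cs : CoxeterSystem M W} {u v : W} (h : BruhatLE cs u v) (h' : BruhatLE cs v u) : u = v := by
  rcases h.eq_or_length_lt with e | l
  · exact e
  · rcases h'.eq_or_length_lt with e | l'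
    · exact e.symm
    · exact absurd l' l.asymm

/-- The Bruhat interval `W^{≤ w} = [1, w]`. -/
def BruhatInterval {B W : Type*} [Group W] {M : CoxeterMatrix B} (cs : CoxeterSystem M W)
    (w : W) : Type _ :=
  {u : W // BruhatLE cs u w}

instance BruhatInterval.instPartialOrder {B W : Type*} [Group W] {M : CoxeterMatrix B}
    (cs : CoxeterSystem M W) (w : W) : PartialOrder (BruhatInterval cs w) where
  le u v := BruhatLE cs u.1 v.1
  le_refl _ := Relation.ReflTransGen.refl
  le_trans _ _ _ h h' := Relation.ReflTransGen.trans h h'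
  le_antisymm _ _ h h' := Subtype.ext (BruhatLE.antisymm h h')

/-! ### Prime spectra relative to a group action -/

/-- A two-sided ideal stable under the action of the group `H`. -/
def IsHStable (H : Type*) {A : Type*} [Group H] [Ring A] [MulSemiringAction H A]
    (I : TwoSidedIdeal A) : Prop :=
  ∀ (h : H) (a : A), a ∈ I → h • a ∈ I

/-- `P` is an `H`-prime ideal: a proper `H`-stable two-sided ideal such that, for `H`-stable
two-sided ideals `I` and `J`, `I J ⊆ P` implies `I ⊆ P` or `J ⊆ P`. -/
structure IsHPrime (H : Type*) {A : Type*} [Group H] [Ring A] [MulSemiringAction H A]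
    (P : TwoSidedIdeal A) : Prop where
  ne_top : P ≠ ⊤
  stable : IsHStable H P
  le_or_le : ∀ I J : TwoSidedIdeal A, IsHStable H I → IsHStable H J →
    (∀ a ∈ I, ∀ b ∈ J, a * b ∈ P) → I ≤ P ∨ J ≤ P

/-- A completely prime ideal: a proper two-sided ideal whose quotient has no zero divisors. -/
structure IsCompletelyPrime {A : Type*} [Ring A] (P : TwoSidedIdeal A) : Prop where
  ne_top : P ≠ ⊤
  mem_or_mem : ∀ a b : A, a * b ∈ P → a ∈ P ∨ b ∈ P

/-- The `H`-prime spectrum `Spec_H A`, partially ordered by inclusion. -/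
abbrev HSpec (H A : Type*) [Group H] [Ring A] [MulSemiringAction H A] : Type _ :=
  {P : TwoSidedIdeal A // IsHPrime H P}

/-! ### Ore extensions and Cauchon extensions -/

/-- `S = R[x; τ, δ]`: `δ` is a (left) `τ`-derivation of `R`, the ring `S` contains `R` (through the
embedding `ι`), `S` is a free left `R`-module with basis `1, x, x², …`, and
`x r = τ(r) x + δ(r)` for all `r ∈ R`. -/
structure IsOreExtension {k R S : Type*} [Field k] [Ring R] [Algebra k R] [Ring S] [Algebra k S]
    (ι : R →ₐ[k] S) (x : S) (τ : R ≃ₐ[k] R) (δ : R →ₗ[k] R) : Prop where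
  leibniz : ∀ r s : R, δ (r * s) = τ r * δ s + δ r * s
  injective : Function.Injective ι
  basis : ∀ s : S, ∃! p : ℕ →₀ R, s = p.sum fun n r => ι r * x ^ n
  commutation : ∀ r : R, x * ι r = ι (τ r) * x + ι (δ r)

/-- The Ore extension `S = R[x; τ, δ]` of the noetherian `k`-algebra `R` is a Cauchon extension with
respect to the scalar `q` and the abelian group `H`, which acts by `k`-algebra automorphisms
on `S` and on `R`. The field `equivariant` says that `R`, embedded by `ι`, is an `H`-stable
subalgebra of `S` and that its `H`-action is the restricted one. -/
structure IsCauchonExtension {k R S : Type*} [Field k] [Ring R] [Algebra k R] [Ring S]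
    [Algebra k S] (q : kˣ) (H : Type*) [CommGroup H]
    [MulSemiringAction H R] [SMulCommClass H k R] [MulSemiringAction H S] [SMulCommClass H k S]
    (ι : R →ₐ[k] S) (x : S) (τ : R ≃ₐ[k] R) (δ : R →ₗ[k] R) : Prop where
  noetherian_left : IsNoetherianRing R
  noetherian_right : IsNoetherianRing Rᵐᵒᵖ
  ore : IsOreExtension ι x τ δ
  locally_nilpotent : ∀ r : R, ∃ n : ℕ, (δ ^ n) r = 0
  skew : ∀ r : R, δ (τ r) = (q : k) • τ (δ r)
  q_not_root_of_unity : ¬ IsOfFinOrder q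
  equivariant : ∀ (h : H) (r : R), ι (h • r) = h • ι r
  x_ne_zero : x ≠ 0
  x_eigenvector : ∀ h : H, ∃ c : k, h • x = c • x
  exists_h₀ : ∃ h₀ : H, (∀ r : R, h₀ • r = τ r) ∧
    ∃ c : kˣ, h₀ • x = (c : k) • x ∧ ¬ IsOfFinOrder c
  completely_prime : ∀ P : TwoSidedIdeal R, IsHPrime H P → IsCompletelyPrime P

/-! Both sides acquire the same factor, a two-element chain (`Prop`, with `False < True`).

Bruhat side: write `s` for the generator. Since `s ≰ w`, right multiplication by `s` raises the
length of every `u ≤ w` by one, and `[1, ws]` is the disjoint union of `[1, w]` and `[1, w]s`. For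
`u, v ≤ w`, both `us ≤ vs` and `u ≤ vs` amount to `u ≤ v`, while `us ≤ v` would force `s ≤ w`. The
substantial input is `bruhatLE_mul_simple_iff`, which rests on the strong exchange property,
obtained here from a parity cocycle counting inversions.

Ring side: an `H`-prime `P` of `R[x; τ]` is determined by `P ∩ R` and by whether `x ∈ P`. If `x ∉
P`, then `x` is regular modulo `P`, and the distinct powers of the `h₀`-eigenvalue of `x` separate
degrees, so `P` contains every coefficient of its elements (`coeff_mem_of_X_notMem`). Conversely,
each `H`-prime `I` of `R` is completely prime and yields exactly two primes, `I[x; τ]` and `I + Sx`.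
-/

/-! ### Inversion parity and strong exchange. -/

namespace CoxeterSystem

variable {B W : Type*} [Group W] {M : CoxeterMatrix B} (cs : CoxeterSystem M W)

open Classical in
/-- The action of a simple reflection on `W × ZMod 2`: conjugation on the first factor, and a sign
change over the simple reflection itself. -/
noncomputable def signedConj (i : B) : Equiv.Perm (W × ZMod 2) :=
  Function.Involutive.toPerm
    (fun p => (cs.simple i * p.1 * cs.simple i, p.2 + if p.1 = cs.simple i then 1 else 0)) <| by
    rintro ⟨t, z⟩
    have h : cs.simple i * t * cs.simple i = cs.simple i ↔ t = cs.simple i := by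
      rw [mul_eq_right, mul_eq_one_iff_eq_inv', inv_simple]
    have h2 : ∀ c : ZMod 2, c + c = 0 := by decide
    ext
    · simp [mul_assoc]
    · simp only [h, add_assoc, h2, add_zero]

open Classical in
theorem signedConj_apply (i : B) (p : W × ZMod 2) :
    cs.signedConj i p =
      (cs.simple i * p.1 * cs.simple i, p.2 + if p.1 = cs.simple i then 1 else 0) := rfl

-- With `c = s_i s_j`, the relation `s_j c^l = c^{-l} s_j` turns each sign-change condition into
-- `c^l t = s_j`; each factor `s_i s_j` contributes two consecutive values of `l`.
open Classical in
theorem signedConj_mul_pow_apply (i j : B) (n : ℕ) (p : W × ZMod 2) :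
    ((cs.signedConj i * cs.signedConj j) ^ n) p =
      ((cs.simple i * cs.simple j) ^ n * p.1 * ((cs.simple i * cs.simple j) ^ n)⁻¹,
        p.2 + ∑ l ∈ Finset.range (2 * n),
          if (cs.simple i * cs.simple j) ^ l * p.1 = cs.simple j then 1 else 0) := by
  induction n with
  | zero => simp
  | succ n ih =>
    set c := cs.simple i * cs.simple j with hc
    have hjc : ∀ l : ℕ, cs.simple j * c ^ l = (c ^ l)⁻¹ * cs.simple j := by
      intro l
      have := (show SemiconjBy (cs.simple j) c c⁻¹ by
        simp [SemiconjBy, hc, mul_assoc]).pow_right l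
      simpa [SemiconjBy] using this
    have e1 : c ^ n * p.1 * (c ^ n)⁻¹ = cs.simple j ↔ c ^ (2 * n) * p.1 = cs.simple j := by
      rw [mul_inv_eq_iff_eq_mul, hjc, two_mul, pow_add, mul_assoc, eq_inv_mul_iff_mul_eq]
    have e2 : cs.simple j * (c ^ n * p.1 * (c ^ n)⁻¹) * cs.simple j = cs.simple i ↔
        c ^ (2 * n + 1) * p.1 = cs.simple j := by
      have hi : cs.simple i = c * cs.simple j := by simp [hc]
      rw [hi, mul_left_inj, ← mul_assoc, mul_inv_eq_iff_eq_mul, ← mul_assoc, hjc, mul_assoc,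
        inv_mul_eq_iff_eq_mul, ← eq_inv_mul_iff_mul_eq, inv_simple, ← pow_succ', ← pow_add, hjc,
        eq_inv_mul_iff_mul_eq, two_mul, add_assoc]
    rw [pow_succ', Equiv.Perm.mul_apply, ih, Equiv.Perm.mul_apply, signedConj_apply,
      signedConj_apply]
    ext
    · simp [pow_succ', hc, mul_assoc]
    · rw [show 2 * (n + 1) = 2 * n + 1 + 1 by ring, Finset.sum_range_succ, Finset.sum_range_succ]
      simp only [e1, e2, add_assoc]

theorem isLiftable_signedConj : M.IsLiftable cs.signedConj := by
  classical
  intro i j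
  ext p : 1
  have h2 : ∀ c : ZMod 2, c + c = 0 := by decide
  -- As `c ^ M i j = 1`, the two halves of the sum coincide and cancel modulo 2.
  rw [signedConj_mul_pow_apply, two_mul, Finset.sum_range_add]
  simp [pow_add, h2]

/-- The parity of the number of times `t` occurs in the right inversion sequence of a word
for `w`. -/
noncomputable def inversionParity (w t : W) : ZMod 2 :=
  (cs.lift ⟨cs.signedConj, cs.isLiftable_signedConj⟩ w (t, 0)).2

theorem lift_signedConj_apply (w t : W) (z : ZMod 2) :
    cs.lift ⟨cs.signedConj, cs.isLiftable_signedConj⟩ w (t, z) =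
      (w * t * w⁻¹, z + cs.inversionParity w t) := by
  classical
  unfold inversionParity
  induction w using cs.simple_induction_left generalizing z with
  | one => simp
  | mul_simple_left w i ih =>
    rw [map_mul, Equiv.Perm.mul_apply, Equiv.Perm.mul_apply, ih, ih 0, lift_apply_simple,
      signedConj_apply, signedConj_apply]
    simp [mul_assoc, add_assoc]

theorem inversionParity_mul (u v t : W) :
    cs.inversionParity (u * v) t =
      cs.inversionParity v t + cs.inversionParity u (v * t * v⁻¹) := by
  conv_lhs => rw [inversionParity, map_mul, Equiv.Perm.mul_apply, lift_signedConj_apply,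
    lift_signedConj_apply]
  simp

open Classical in
theorem inversionParity_simple (i : B) (t : W) :
    cs.inversionParity (cs.simple i) t = if t = cs.simple i then 1 else 0 := by
  rw [inversionParity, lift_apply_simple, signedConj_apply, zero_add]

theorem inversionParity_one (t : W) : cs.inversionParity 1 t = 0 := by
  simp [inversionParity]

/-- For `t = u s u⁻¹` the cocycle rule gives contributions of `u`, `s` and `u⁻¹`. Those of `u` and
`u⁻¹` cancel, as the same rule for `u u⁻¹ = 1` shows, and `s` contributes 1. -/
theorem IsReflection.inversionParity_self {cs : CoxeterSystem M W} {t : W}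
    (ht : cs.IsReflection t) : cs.inversionParity t t = 1 := by
  obtain ⟨u, i, rfl⟩ := ht
  have h : cs.inversionParity (u * u⁻¹) (u * cs.simple i * u⁻¹) = 0 := by
    rw [mul_inv_cancel, inversionParity_one]
  rw [inversionParity_mul] at h
  rw [inversionParity_mul, inversionParity_mul]
  have e : u⁻¹ * (u * cs.simple i * u⁻¹) * u⁻¹⁻¹ = cs.simple i := by group
  rw [e] at h ⊢
  rw [inversionParity_simple, if_pos rfl, simple_mul_simple_self, one_mul, inv_simple,
    add_left_comm, h, add_zero]

theorem mem_rightInvSeq_of_inversionParity_ne_zero {ω : List B} {t : W}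
    (h : cs.inversionParity (cs.wordProd ω) t ≠ 0) : t ∈ cs.rightInvSeq ω := by
  induction ω with
  | nil => exact absurd (by simp [inversionParity_one]) h
  | cons i ω ih =>
    rw [wordProd_cons, inversionParity_mul, inversionParity_simple] at h
    rw [rightInvSeq, List.mem_cons]
    split_ifs at h with e
    · left
      rw [← e]
      group
    · exact Or.inr (ih (by simpa using h))

theorem isRightInversion_of_inversionParity_ne_zero {w t : W}
    (h : cs.inversionParity w t ≠ 0) : cs.IsRightInversion w t := by
  obtain ⟨ω, hω, rfl⟩ := cs.exists_isReduced w
  exact cs.isRightInversion_of_mem_rightInvSeq hω (cs.mem_rightInvSeq_of_inversionParity_ne_zero h)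

/-- Passing from `w` to `wt` flips the parity at `t`, so parity zero would make `t` an inversion of
both, whereas it is an inversion of exactly one. -/
theorem IsRightInversion.inversionParity_ne_zero {cs : CoxeterSystem M W} {w t : W}
    (h : cs.IsRightInversion w t) : cs.inversionParity w t ≠ 0 := by
  intro h0
  have : cs.IsRightInversion (w * t) t := by
    apply cs.isRightInversion_of_inversionParity_ne_zero
    rw [inversionParity_mul, h.1.inversionParity_self, mul_assoc, mul_inv_cancel, mul_one, h0,
      add_zero]
    exact one_ne_zero
  exact h.1.isRightInversion_mul_left_iff.mp this h

/-- The form of strong exchange needed for the Bruhat order: away from `s` itself, the cocycle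
carries inversions of `vs` to inversions of `v`. -/
theorem IsRightInversion.of_mul_simple {cs : CoxeterSystem M W} {v t : W} {i : B}
    (h : cs.IsRightInversion (v * cs.simple i) t) (ht : t ≠ cs.simple i) :
    cs.IsRightInversion v (cs.simple i * t * cs.simple i) := by
  have := h.inversionParity_ne_zero
  rw [inversionParity_mul, inversionParity_simple, if_neg ht, zero_add, inv_simple] at this
  exact cs.isRightInversion_of_inversionParity_ne_zero this

end CoxeterSystem

/-! ### The Bruhat interval below `w s` when `s` is not below `w`. -/

section Bruhat

variable {B W : Type*} [Group W] {M : CoxeterMatrix B} {cs : CoxeterSystem M W}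

theorem BruhatLE.refl (u : W) : BruhatLE cs u u := Relation.ReflTransGen.refl

theorem BruhatLE.trans {u v w : W} (h : BruhatLE cs u v) (h' : BruhatLE cs v w) :
    BruhatLE cs u w := Relation.ReflTransGen.trans h h'

theorem BruhatLE.mul_simple_of_lt {u : W} {i : B}
    (h : cs.length u < cs.length (u * cs.simple i)) : BruhatLE cs u (u * cs.simple i) :=
  .single ⟨_, cs.isReflection_simple i, rfl, h⟩

theorem BruhatLE.simple_mul_of_lt {u : W} {i : B}
    (h : cs.length u < cs.length (cs.simple i * u)) : BruhatLE cs u (cs.simple i * u) :=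
  .single ⟨u⁻¹ * cs.simple i * u, by simpa using (cs.isReflection_simple i).conj u⁻¹, by group, h⟩

/-- A simple reflection lies below every element ending in it with additive length. -/
theorem BruhatLE.simple_le_mul_simple {u : W} {i : B}
    (h : cs.length u < cs.length (u * cs.simple i)) :
    BruhatLE cs (cs.simple i) (u * cs.simple i) := by
  obtain ⟨ω, hω, rfl⟩ := cs.exists_isReduced u
  induction ω with
  | nil => simpa using BruhatLE.refl _
  | cons j ω ih =>
    have hr : cs.IsReduced ω := by simpa using hω.drop 1
    have h1 : cs.length (cs.wordProd (j :: ω)) = ω.length + 1 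
      := hω
    have h2 : cs.length (cs.wordProd ω) = ω.length := hr
    rw [h1, cs.wordProd_cons, mul_assoc] at h
    have h3 := cs.length_simple_mul (cs.wordProd ω * cs.simple i) j
    have h4 := cs.length_mul_simple (cs.wordProd ω) i
    rw [cs.wordProd_cons, mul_assoc]
    exact (ih hr (by omega)).trans (BruhatLE.simple_mul_of_lt (by omega))

theorem length_mul_simple_of_not_le {v : W} {i : B} (h : ¬ BruhatLE cs (cs.simple i) v) :
    cs.length (v * cs.simple i) = cs.length v + 1 := by
  rcases cs.length_mul_simple v i with h' | h'
  · exact h'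
  · refine absurd ?_ h
    have := BruhatLE.simple_le_mul_simple (cs := cs) (u := v * cs.simple i) (i := i)
      (by simpa using (show _ < cs.length v by omega))
    simpa using this

theorem not_simple_le_of_le {u v : W} {i : B} (h : ¬ BruhatLE cs (cs.simple i) v)
    (huv : BruhatLE cs u v) : ¬ BruhatLE cs (cs.simple i) u := fun h' => h (h'.trans huv)

theorem BruhatLE.le_mul_simple {v : W} {i : B} (h : ¬ BruhatLE cs (cs.simple i) v) :
    BruhatLE cs v (v * cs.simple i) :=
  .mul_simple_of_lt (by rw [length_mul_simple_of_not_le h]; omega)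

/-- Every element of the chain avoids `s`, so all lengths rise by one, and each step survives with
its reflection conjugated by `s`. -/
theorem BruhatLE.mul_simple {u v : W} {i : B} (h : ¬ BruhatLE cs (cs.simple i) v)
    (huv : BruhatLE cs u v) : BruhatLE cs (u * cs.simple i) (v * cs.simple i) := by
  induction huv using Relation.ReflTransGen.head_induction_on with
  | refl => exact .refl _
  | head hs hle ih =>
    rename_i a c
    refine .trans (.single ?_) ih
    have hc := not_simple_le_of_le h hle
    have ha := not_simple_le_of_le hc (.single hs)
    obtain ⟨t, ht, rfl, hlt⟩ := hs
    refine ⟨cs.simple i * t * cs.simple i, by simpa using ht.conj (cs.simple i),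
      by simp [mul_assoc], ?_⟩
    rw [length_mul_simple_of_not_le hc, length_mul_simple_of_not_le ha]
    omega

theorem bruhatLE_mul_simple_iff {u v : W} {i : B} (h : ¬ BruhatLE cs (cs.simple i) v) :
    BruhatLE cs u (v * cs.simple i) ↔
      BruhatLE cs u v ∨ BruhatLE cs (u * cs.simple i) v := by
  constructor
  · intro hu
    induction hu using Relation.ReflTransGen.head_induction_on with
    | refl => exact Or.inr (by simpa using BruhatLE.refl _)
    | head hs hle ih =>
      rename_i a c
      rcases ih with ih | ih
      · exact Or.inl (.trans (.single hs) ih)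
      · obtain ⟨t, ht, rfl, hlt⟩ := hs
        set v' := a * t * cs.simple i with hv'
        have hat : a * t = v' * cs.simple i := by simp [hv']
        by_cases e : t = cs.simple i
        · left
          simpa [hv', e] using ih
        · right
          -- Strong exchange: `a = v' s t` is shorter than `v' s`, hence `a s = v' (s t s)` is
          -- shorter than `v'`, a Bruhat step up to `v' ≤ v`.
          have hinv : cs.IsRightInversion (v' * cs.simple i) t := by
            refine ⟨ht, ?_⟩
            rwa [← hat, mul_assoc, ht.mul_self, mul_one]
          have h' := hinv.of_mul_simple e
          have ha : v' * (cs.simple i * t * cs.simple i) = a * cs.simple i := by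
            rw [← mul_assoc, ← mul_assoc, ← hat, mul_assoc a, ht.mul_self, mul_one]
          refine .trans (.single ⟨_, h'.1, ?_, ?_⟩) ih
          · rw [← ha, mul_assoc v', h'.1.mul_self, mul_one]
          · rw [← ha]; exact h'.2
  · rintro (hu | hu)
    · exact hu.trans (.le_mul_simple h)
    · simpa using hu.mul_simple h

theorem not_mul_simple_le {u v : W} {i : B} (h : ¬ BruhatLE cs (cs.simple i) v)
    (hu : ¬ BruhatLE cs (cs.simple i) u) : ¬ BruhatLE cs (u * cs.simple i) v := fun h' =>
  not_simple_le_of_le h h' (.simple_le_mul_simple (by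
    rw [length_mul_simple_of_not_le hu]; omega))

open Classical in
/-- If the simple reflection `a` is not below `w`, then `[1, w a]` is the product of `[1, w]` with
a two-element chain. -/
theorem nonempty_bruhatInterval_prod_orderIso {w : W} {i : B}
    (h : ¬ BruhatLE cs (cs.simple i) w) :
    Nonempty (BruhatInterval cs w × Prop ≃o BruhatInterval cs (w * cs.simple i)) := by
  let f : BruhatInterval cs w × Prop → BruhatInterval cs (w * cs.simple i) := fun p =>
    ⟨if p.2 then p.1.1 * cs.simple i else p.1.1, by
      split_ifs
      · exact p.1.2.mul_simple h
      · exact p.1.2.trans (.le_mul_simple h)⟩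
  have hf : ∀ p q, f p ≤ f q ↔ p ≤ q := by
    rintro ⟨u, a⟩ ⟨v, b⟩
    have hu := not_simple_le_of_le h u.2
    have hv := not_simple_le_of_le h v.2
    have hs : ¬ BruhatLE cs (u.1 * cs.simple i) v.1 := not_mul_simple_le hv hu
    change BruhatLE cs (if a then u.1 * cs.simple i else u.1)
      (if b then v.1 * cs.simple i else v.1) ↔ BruhatLE cs u.1 v.1 ∧ (a → b)
    rcases Classical.em a with ha | ha <;> rcases Classical.em b with hb | hb
    · rw [if_pos ha, if_pos hb, bruhatLE_mul_simple_iff hv,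
        CoxeterSystem.simple_mul_simple_cancel_right]
      exact ⟨fun h' => ⟨h'.resolve_left hs, fun _ => hb⟩, fun h' => Or.inr h'.1⟩
    · rw [if_pos ha, if_neg hb]
      exact ⟨fun h' => absurd h' hs, fun h' => absurd (h'.2 ha) hb⟩
    · rw [if_neg ha, if_pos hb]
      refine ⟨fun h' => ⟨?_, fun _ => hb⟩, fun h' => h'.1.trans (.le_mul_simple hv)⟩
      exact ((bruhatLE_mul_simple_iff hv).1 h').resolve_right hs
    · rw [if_neg ha, if_neg hb]
      exact ⟨fun h' => ⟨h', fun h => absurd h ha⟩, fun h' => h'.1⟩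
  refine ⟨⟨Equiv.ofBijective f ⟨?_, ?_⟩, fun {p q} => hf p q⟩⟩
  · intro p q hpq
    exact le_antisymm ((hf _ _).1 hpq.le) ((hf _ _).1 hpq.ge)
  · rintro ⟨u, hu⟩
    rcases (bruhatLE_mul_simple_iff h).1 hu with hu | hu
    · exact ⟨(⟨u, hu⟩, False), Subtype.ext (if_neg id)⟩
    · exact ⟨(⟨_, hu⟩, True), Subtype.ext (by simp [f])⟩

end Bruhat

/-! ### Two-sided ideals and `H`-primes. -/

theorem TwoSidedIdeal.smul_mem' {k A : Type*} [Field k] [Ring A] [Algebra k A]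
    (P : TwoSidedIdeal A) (c : k) {a : A} (ha : a ∈ P) : c • a ∈ P := by
  rw [Algebra.smul_def]
  exact P.mul_mem_left _ _ ha

theorem TwoSidedIdeal.mem_of_smul_mem {k A : Type*} [Field k] [Ring A] [Algebra k A]
    (P : TwoSidedIdeal A) {c : k} (hc : c ≠ 0) {a : A} (ha : c • a ∈ P) : a ∈ P := by
  simpa [smul_smul, hc] using P.smul_mem' c⁻¹ ha

theorem IsHStable.smul_mem_iff {H A : Type*} [Group H] [Ring A] [MulSemiringAction H A]
    {P : TwoSidedIdeal A} (hP : IsHStable H P) (h : H) {a : A} : h • a ∈ P ↔ a ∈ P :=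
  ⟨fun ha => by simpa using hP h⁻¹ _ ha, hP h a⟩

theorem IsCompletelyPrime.isHPrime {H A : Type*} [Group H] [Ring A] [MulSemiringAction H A]
    {P : TwoSidedIdeal A} (hP : IsCompletelyPrime P) (hs : IsHStable H P) : IsHPrime H P where
  ne_top := hP.ne_top
  stable := hs
  le_or_le I J _ _ hIJ := by
    by_contra! hn
    obtain ⟨a, haI, haP⟩ := Set.not_subset.1 hn.1
    obtain ⟨b, hbJ, hbP⟩ := Set.not_subset.1 hn.2
    exact (hP.mem_or_mem a b (hIJ a haI b hbJ)).elim haP hbP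

theorem TwoSidedIdeal.ne_top_iff_one_notMem {A : Type*} [Ring A] {P : TwoSidedIdeal A} :
    P ≠ ⊤ ↔ (1 : A) ∉ P := (P.one_mem_iff).symm.not

/-! ### Coefficients and ideals in Ore extensions. -/

namespace IsOreExtension

variable {k R S : Type*} [Field k] [Ring R] [Algebra k R] [Ring S] [Algebra k S]
  {ι : R →ₐ[k] S} {x : S} {τ : R ≃ₐ[k] R}

/-- The isomorphism of additive groups sending an element of an Ore extension to its
coefficients. -/
noncomputable def repr {δ : R →ₗ[k] R} (h : IsOreExtension ι x τ δ) : S ≃+ (ℕ →₀ R) :=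
  (AddEquiv.ofBijective
    (Finsupp.liftAddHom fun n => (AddMonoidHom.mulRight (x ^ n)).comp (ι : R →+ S))
    (Function.bijective_iff_existsUnique _ |>.2 fun s => by
      obtain ⟨p, hp, hu⟩ := h.basis s
      exact ⟨p, hp.symm, fun y hy => hu y hy.symm⟩)).symm

/-- The coefficient of `x ^ n` of an element of an Ore extension. -/
noncomputable def coeff {δ : R →ₗ[k] R} (h : IsOreExtension ι x τ δ) (n : ℕ) : S →+ R :=
  (Finsupp.applyAddHom n).comp h.repr.toAddMonoidHom

section

variable {δ : R →ₗ[k] R} (h : IsOreExtension ι x τ δ)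

theorem repr_symm_single (n : ℕ) (r : R) :
    h.repr.symm (Finsupp.single n r) = ι r * x ^ n := by
  simp [repr]

theorem coeff_monomial (n m : ℕ) (r : R) :
    h.coeff n (ι r * x ^ m) = if m = n then r else 0 := by
  rw [← h.repr_symm_single]
  simp [coeff, Finsupp.single_apply]

include h in
/-- Additive properties of elements of an Ore extension can be checked on monomials. -/
theorem induction_on {p : S → Prop} (s : S) (monomial : ∀ r n, p (ι r * x ^ n))
    (add : ∀ s t, p s → p t → p (s + t)) : p s := by
  rw [← h.repr.symm_apply_apply s]
  induction h.repr s using Finsupp.induction_linear with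
  | zero => simpa using monomial 0 0
  | add f g hf hg => rw [map_add]; exact add _ _ hf hg
  | single n r => rw [h.repr_symm_single]; exact monomial r n

theorem sum_coeff (s : S) : s = ∑ n ∈ (h.repr s).support, ι (h.coeff n s) * x ^ n := by
  conv_lhs => rw [← h.repr.symm_apply_apply s, ← Finsupp.sum_single (h.repr s), Finsupp.sum,
    map_sum]
  simp only [h.repr_symm_single]
  rfl

theorem exists_forall_coeff_eq_zero (s : S) : ∃ F : Finset ℕ, ∀ n ∉ F, h.coeff n s = 0 :=
  ⟨(h.repr s).support, fun _ hn => Finsupp.notMem_support_iff.1 hn⟩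

theorem mem_of_coeff_mem {P : TwoSidedIdeal S} {s : S} (hs : ∀ n, ι (h.coeff n s) ∈ P) :
    s ∈ P := by
  rw [h.sum_coeff s]
  exact P.finsetSum_mem _ _ fun n _ => P.mul_mem_right _ _ (hs n)

theorem coeff_ι (n : ℕ) (r : R) : h.coeff n (ι r) = if n = 0 then r else 0 := by
  simpa [eq_comm] using h.coeff_monomial n 0 r

theorem coeff_X (n : ℕ) : h.coeff n x = if n = 1 then 1 else 0 := by
  simpa [eq_comm] using h.coeff_monomial n 1 1

theorem coeff_one_zero : h.coeff 0 1 = 1 := by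
  simpa using h.coeff_ι 0 1

theorem coeff_algebra_smul (a : k) (n : ℕ) (s : S) : h.coeff n (a • s) = a • h.coeff n s := by
  induction s using h.induction_on with
  | add s t hs ht => simp only [smul_add, map_add, hs, ht]
  | monomial r m =>
    rw [← smul_mul_assoc, ← map_smul, h.coeff_monomial, h.coeff_monomial]
    split_ifs
    · rfl
    · rw [smul_zero]

/-- Division with remainder by `x`. -/
theorem exists_eq_coeff_zero_add_mul_X (s : S) : ∃ u, s = ι (h.coeff 0 s) + u * x := by
  induction s using h.induction_on with
  | monomial r n =>
    cases n with
    | zero => exact ⟨0, by simp [h.coeff_ι]⟩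
    | succ n => exact ⟨ι r * x ^ n, by
      rw [h.coeff_monomial, if_neg n.succ_ne_zero, map_zero, zero_add, pow_succ, mul_assoc]⟩
  | add s t hs ht =>
    obtain ⟨u, hu⟩ := hs
    obtain ⟨v, hv⟩ := ht
    refine ⟨u + v, ?_⟩
    conv_lhs => rw [hu, hv]
    rw [map_add, map_add, add_mul]
    abel

end

variable (h : IsOreExtension ι x τ (0 : R →ₗ[k] R))

include h in
theorem X_pow_mul_ι (n : ℕ) (r : R) : x ^ n * ι r = ι ((τ ^ n) r) * x ^ n := by
  induction n generalizing r with
  | zero => simp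
  | succ n ih =>
    have := h.commutation r
    rw [LinearMap.zero_apply, map_zero, add_zero] at this
    rw [pow_succ, mul_assoc, this, ← mul_assoc, ih, mul_assoc, pow_succ]
    rfl

/-- With zero derivation `S` is graded by degree in `x`; moving `x ^ i` past a coefficient applies
`τ ^ i`. Both sides are biadditive, so monomials suffice. -/
theorem coeff_mul (n : ℕ) (s t : S) : h.coeff n (s * t) =
    ∑ p ∈ Finset.HasAntidiagonal.antidiagonal n, h.coeff p.1 s * (τ ^ p.1) (h.coeff p.2 t) := by
  induction s using h.induction_on with
  | add s s' hs hs' => simp only [add_mul, map_add, hs, hs', Finset.sum_add_distrib]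
  | monomial r a =>
    induction t using h.induction_on with
    | add t t' ht ht' => simp only [mul_add, map_add, ht, ht', Finset.sum_add_distrib]
    | monomial r' b =>
      have e : ι r * x ^ a * (ι r' * x ^ b) = ι (r * (τ ^ a) r') * x ^ (a + b) := by
        rw [mul_assoc, ← mul_assoc (x ^ a), h.X_pow_mul_ι, map_mul, pow_add]
        simp only [mul_assoc]
      simp only [e, h.coeff_monomial]
      split_ifs with hn
      · rw [Finset.sum_eq_single (a, b)]
        · simp
        · rintro ⟨i, j⟩ _ hij
          by_cases hi : a = i
          · have hj : b ≠ j := fun hj => hij (by rw [hi, hj])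
            simp [hj]
          · simp [hi]
        · intro hm
          exact absurd (Finset.HasAntidiagonal.mem_antidiagonal.2 hn) hm
      · refine (Finset.sum_eq_zero ?_).symm
        rintro ⟨i, j⟩ hij
        have hij := Finset.HasAntidiagonal.mem_antidiagonal.1 hij
        by_cases hi : a = i
        · have hj : b ≠ j := fun hj => hn (by rw [hi, hj]; exact hij)
          simp [hj]
        · simp [hi]

theorem coeff_zero_mul (s t : S) : h.coeff 0 (s * t) = h.coeff 0 s * h.coeff 0 t := by
  simp [h.coeff_mul]

theorem coeff_mul_X (n : ℕ) (s : S) : h.coeff (n + 1) (s * x) = h.coeff n s := by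
  rw [h.coeff_mul, Finset.sum_eq_single (n, 1)]
  · simp [h.coeff_X]
  · rintro ⟨i, j⟩ hij hne
    have hij := Finset.HasAntidiagonal.mem_antidiagonal.1 hij
    have hj : j ≠ 1 := fun hj => hne (by ext <;> simp at * <;> omega)
    simp [h.coeff_X, hj]
  · intro hm
    exact absurd (Finset.HasAntidiagonal.mem_antidiagonal.2 (by rfl)) hm

theorem coeff_X_mul (n : ℕ) (s : S) : h.coeff (n + 1) (x * s) = τ (h.coeff n s) := by
  rw [h.coeff_mul, Finset.sum_eq_single (1, n)]
  · simp [h.coeff_X]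
  · rintro ⟨i, j⟩ hij hne
    have hij := Finset.HasAntidiagonal.mem_antidiagonal.1 hij
    have hi : i ≠ 1 := fun hi => hne (by ext <;> simp at * <;> omega)
    simp [h.coeff_X, hi]
  · intro hm
    exact absurd (Finset.HasAntidiagonal.mem_antidiagonal.2 (add_comm 1 n)) hm

include h in
theorem exists_X_mul_eq (s : S) : ∃ u, x * s = u * x := by
  obtain ⟨u, hu⟩ := h.exists_eq_coeff_zero_add_mul_X (x * s)
  refine ⟨u, ?_⟩
  rwa [h.coeff_zero_mul, h.coeff_X, if_neg zero_ne_one, zero_mul, map_zero, zero_add] at hu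

include h in
theorem exists_mul_X_eq (s : S) : ∃ u, s * x = x * u := by
  induction s using h.induction_on with
  | monomial r n =>
    refine ⟨ι (τ.symm r) * x ^ n, ?_⟩
    have := h.X_pow_mul_ι 1 (τ.symm r)
    rw [pow_one, pow_one, AlgEquiv.apply_symm_apply] at this
    rw [← mul_assoc, this, mul_assoc, mul_assoc, ← pow_succ, ← pow_succ']
  | add s t hs ht =>
    obtain ⟨u, hu⟩ := hs
    obtain ⟨v, hv⟩ := ht
    exact ⟨u + v, by rw [add_mul, hu, hv, mul_add]⟩

/-- The two-sided ideal `I[x; τ]` of `R[x; τ]`, for a `τ`-stable ideal `I` of `R`. -/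
noncomputable def extend (I : TwoSidedIdeal R) (hI : ∀ r ∈ I, τ r ∈ I) : TwoSidedIdeal S :=
  .mk' {s | ∀ n, h.coeff n s ∈ I}
    (fun n => by rw [map_zero]; exact I.zero_mem)
    (fun ha hb n => by rw [map_add]; exact I.add_mem (ha n) (hb n))
    (fun ha n => by rw [map_neg]; exact I.neg_mem (ha n))
    (fun {a b} hb n => by
      have hI' : ∀ i : ℕ, ∀ r ∈ I, (τ ^ i) r ∈ I := by
        intro i
        induction i with
        | zero => exact fun r hr => hr
        | succ i ih => exact fun r hr => ih _ (hI r hr)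
      rw [h.coeff_mul]
      exact I.finsetSum_mem _ _ fun p _ => I.mul_mem_left _ _ (hI' _ _ (hb _)))
    (fun {a b} ha n => by
      rw [h.coeff_mul]
      exact I.finsetSum_mem _ _ fun p _ => I.mul_mem_right _ _ (ha _))

theorem mem_extend {I : TwoSidedIdeal R} {hI : ∀ r ∈ I, τ r ∈ I} {s : S} :
    s ∈ h.extend I hI ↔ ∀ n, h.coeff n s ∈ I := TwoSidedIdeal.mem_mk' ..

/-- The constant coefficient, a ring homomorphism from `R[x; τ]` to `R`. -/
noncomputable def constantCoeff : S →+* R :=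
  { h.coeff 0 with
    map_one' := h.coeff_one_zero
    map_mul' := h.coeff_zero_mul }

theorem mem_comap_constantCoeff {I : TwoSidedIdeal R} {s : S} :
    s ∈ I.comap h.constantCoeff ↔ h.coeff 0 s ∈ I := TwoSidedIdeal.mem_comap _

/-- The ideal generated by the normal element `x` of `R[x; τ]`. -/
def spanX : TwoSidedIdeal S :=
  .mk' {s | ∃ u, s = u * x}
    ⟨0, by simp⟩
    (by rintro _ _ ⟨u, rfl⟩ ⟨v, rfl⟩; exact ⟨u + v, by rw [add_mul]⟩)
    (by rintro _ ⟨u, rfl⟩; exact ⟨-u, by rw [neg_mul]⟩)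
    (by rintro a _ ⟨u, rfl⟩; exact ⟨a * u, by rw [mul_assoc]⟩)
    (by
      rintro _ b ⟨u, rfl⟩
      obtain ⟨v, hv⟩ := h.exists_X_mul_eq b
      exact ⟨u * v, by rw [mul_assoc, hv, mul_assoc]⟩)

theorem mem_spanX {s : S} : s ∈ h.spanX ↔ ∃ u, s = u * x := TwoSidedIdeal.mem_mk' ..

/-- The elements whose product with the normal element `x` lies in `P`. -/
def divX (P : TwoSidedIdeal S) : TwoSidedIdeal S :=
  .mk' {s | s * x ∈ P}
    (by simp)
    (fun {a b} ha hb => by rw [Set.mem_ofPred, add_mul]; exact P.add_mem ha hb)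
    (fun {a} ha => by rw [Set.mem_ofPred, neg_mul]; exact P.neg_mem ha)
    (fun {a b} hb => by rw [Set.mem_ofPred, mul_assoc]; exact P.mul_mem_left _ _ hb)
    (fun {a b} ha => by
      obtain ⟨u, hu⟩ := h.exists_mul_X_eq b
      rw [Set.mem_ofPred, mul_assoc, hu, ← mul_assoc]
      exact P.mul_mem_right _ _ ha)

theorem mem_divX {P : TwoSidedIdeal S} {s : S} : s ∈ h.divX P ↔ s * x ∈ P :=
  TwoSidedIdeal.mem_mk' ..

theorem isCompletelyPrime_extend {I : TwoSidedIdeal R} (hI : ∀ r, τ r ∈ I ↔ r ∈ I)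
    (hc : IsCompletelyPrime I) : IsCompletelyPrime (h.extend I fun r hr => (hI r).2 hr) where
  ne_top := by
    rw [TwoSidedIdeal.ne_top_iff_one_notMem, h.mem_extend]
    exact fun h1 => TwoSidedIdeal.ne_top_iff_one_notMem.1 hc.ne_top (h.coeff_one_zero ▸ h1 0)
  mem_or_mem a b hab := by
    classical
    have hI' : ∀ i : ℕ, ∀ r, (τ ^ i) r ∈ I ↔ r ∈ I := by
      intro i
      induction i with
      | zero => exact fun r => Iff.rfl
      | succ i ih => exact fun r => (ih _).trans (hI r)
    by_contra! hn
    simp only [h.mem_extend, not_forall] at hn hab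
    obtain ⟨ha, hb⟩ := hn
    set n := Nat.find ha
    set m := Nat.find hb
    -- As in Gauss's lemma: `n` and `m` are the lowest degrees with coefficient outside `I`, so
    -- every other term of degree `n + m` lies in `I`.
    have key : h.coeff n a * (τ ^ n) (h.coeff m b) ∈ I := by
      have h1 := hab (n + m)
      rw [h.coeff_mul, ← Finset.add_sum_erase _ _
        (Finset.HasAntidiagonal.mem_antidiagonal.2 rfl : (n, m) ∈ Finset.HasAntidiagonal.antidiagonal (n + m))] at h1
      refine (add_mem_cancel_right (H := I) ?_).1 h1
      refine I.finsetSum_mem _ _ ?_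
      rintro ⟨i, j⟩ hij
      rw [Finset.mem_erase, Finset.HasAntidiagonal.mem_antidiagonal] at hij
      rcases lt_trichotomy i n with hi | hi | hi
      · exact I.mul_mem_right _ _ (not_not.1 (Nat.find_min ha hi))
      · exact absurd (Prod.ext hi (by simp at hij ⊢; omega)) hij.1
      · have hj : j < m := by simp at hij; omega
        exact I.mul_mem_left _ _ ((hI' _ _).2 (not_not.1 (Nat.find_min hb hj)))
    rcases hc.mem_or_mem _ _ key with h1 | h1
    · exact Nat.find_spec ha h1
    · exact Nat.find_spec hb ((hI' _ _).1 h1)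

theorem isCompletelyPrime_comap_constantCoeff {I : TwoSidedIdeal R} (hc : IsCompletelyPrime I) :
    IsCompletelyPrime (I.comap h.constantCoeff) where
  ne_top := by
    rw [TwoSidedIdeal.ne_top_iff_one_notMem, h.mem_comap_constantCoeff, h.coeff_one_zero]
    exact TwoSidedIdeal.ne_top_iff_one_notMem.1 hc.ne_top
  mem_or_mem a b hab := by
    rw [h.mem_comap_constantCoeff, h.coeff_zero_mul] at hab
    exact (hc.mem_or_mem _ _ hab).imp h.mem_comap_constantCoeff.2 h.mem_comap_constantCoeff.2

end IsOreExtension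

/-! ### The `H`-primes of `R[x; τ]`. -/

namespace IsCauchonExtension

variable {k R S : Type*} [Field k] {q : kˣ} {H : Type*} [CommGroup H]
  [Ring R] [Algebra k R] [Ring S] [Algebra k S]
  [MulSemiringAction H R] [SMulCommClass H k R] [MulSemiringAction H S] [SMulCommClass H k S]
  {ι : R →ₐ[k] S} {x : S} {τ : R ≃ₐ[k] R}
  (hS : IsCauchonExtension q H ι x τ (0 : R →ₗ[k] R))

include hS

theorem exists_eigenvalue (g : H) : ∃ c : k, c ≠ 0 ∧ g • x = c • x := by
  obtain ⟨c, hc⟩ := hS.x_eigenvector g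
  refine ⟨c, ?_, hc⟩
  rintro rfl
  rw [zero_smul, smul_eq_zero_iff_eq] at hc
  exact hS.x_ne_zero hc

theorem coeff_smul {g : H} {c : k} (hc : g • x = c • x) (n : ℕ) (s : S) :
    hS.ore.coeff n (g • s) = c ^ n • g • hS.ore.coeff n s := by
  induction s using hS.ore.induction_on with
  | add s t hs ht => simp only [smul_add, map_add, hs, ht]
  | monomial r m =>
    have e : g • (ι r * x ^ m) = ι (c ^ m • g • r) * x ^ m := by
      rw [smul_mul', smul_pow', hc, smul_pow c, ← hS.equivariant, map_smul ι (c ^ m),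
        mul_smul_comm, smul_mul_assoc (c ^ m)]
    rw [e, hS.ore.coeff_monomial, hS.ore.coeff_monomial]
    split_ifs with hm
    · rw [hm]
    · simp

theorem τ_mem_iff {I : TwoSidedIdeal R} (hI : IsHStable H I) (r : R) : τ r ∈ I ↔ r ∈ I := by
  obtain ⟨h₀, h, -⟩ := hS.exists_h₀
  rw [← h, hI.smul_mem_iff]

theorem isHStable_comap {P : TwoSidedIdeal S} (hP : IsHStable H P) :
    IsHStable H (P.comap ι) := by
  intro g r hr
  rw [TwoSidedIdeal.mem_comap] at hr ⊢
  rw [hS.equivariant]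
  exact hP g _ hr

theorem isHStable_extend {I : TwoSidedIdeal R} (hI : IsHStable H I) :
    IsHStable H (hS.ore.extend I fun r hr => (hS.τ_mem_iff hI r).2 hr) := by
  intro g s hs
  rw [hS.ore.mem_extend] at hs ⊢
  obtain ⟨c, -, hc⟩ := hS.exists_eigenvalue g
  intro n
  rw [hS.coeff_smul hc]
  exact I.smul_mem' _ (hI g _ (hs n))

theorem isHStable_comap_constantCoeff {I : TwoSidedIdeal R} (hI : IsHStable H I) :
    IsHStable H (I.comap hS.ore.constantCoeff) := by
  intro g s hs
  rw [hS.ore.mem_comap_constantCoeff] at hs ⊢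
  obtain ⟨c, -, hc⟩ := hS.exists_eigenvalue g
  rw [hS.coeff_smul hc]
  exact I.smul_mem' _ (hI g _ hs)

theorem isHPrime_comap {P : TwoSidedIdeal S} (hP : IsHPrime H P) : IsHPrime H (P.comap ι) where
  ne_top := by
    rw [TwoSidedIdeal.ne_top_iff_one_notMem, TwoSidedIdeal.mem_comap, map_one]
    exact TwoSidedIdeal.ne_top_iff_one_notMem.1 hP.ne_top
  stable := hS.isHStable_comap hP.stable
  le_or_le I J hI hJ hIJ := by
    have hle : ∀ {K : TwoSidedIdeal R} (hK : IsHStable H K),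
        hS.ore.extend K (fun r hr => (hS.τ_mem_iff hK r).2 hr) ≤ P → K ≤ P.comap ι := by
      intro K hK hKP r hr
      rw [TwoSidedIdeal.mem_comap]
      refine hKP (hS.ore.mem_extend.2 fun n => ?_)
      rw [hS.ore.coeff_ι]
      split_ifs
      · exact hr
      · exact K.zero_mem
    refine (hP.le_or_le _ _ (hS.isHStable_extend hI) (hS.isHStable_extend hJ) ?_).imp
      (hle hI) (hle hJ)
    intro a ha b hb
    rw [hS.ore.mem_extend] at ha hb
    refine hS.ore.mem_of_coeff_mem fun n => ?_
    rw [← TwoSidedIdeal.mem_comap, hS.ore.coeff_mul]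
    refine TwoSidedIdeal.finsetSum_mem _ _ _ fun p _ => hIJ _ (ha _) _ ?_
    have hτ : ∀ i : ℕ, ∀ r ∈ J, (τ ^ i) r ∈ J := by
      intro i
      induction i with
      | zero => exact fun r hr => hr
      | succ i ih => exact fun r hr => ih _ ((hS.τ_mem_iff hJ r).2 hr)
    exact hτ _ _ (hb _)

/-- Since `x` is a normal `H`-eigenvector, `{s | s x ∈ P}` and `S x` are `H`-stable ideals with
product inside `P`; primeness applies. -/
theorem mem_of_mul_X_mem {P : TwoSidedIdeal S} (hP : IsHPrime H P) (hx : x ∉ P) {s : S}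
    (hs : s * x ∈ P) : s ∈ P := by
  refine (hP.le_or_le (hS.ore.divX P) hS.ore.spanX ?_ ?_ ?_).resolve_right ?_
    (hS.ore.mem_divX.2 hs)
  · intro g a ha
    rw [hS.ore.mem_divX] at ha ⊢
    obtain ⟨c, hc0, hc⟩ := hS.exists_eigenvalue g
    have := hP.stable g _ ha
    rw [smul_mul', hc, mul_smul_comm] at this
    exact P.mem_of_smul_mem hc0 this
  · intro g a ha
    rw [hS.ore.mem_spanX] at ha ⊢
    obtain ⟨u, rfl⟩ := ha
    obtain ⟨c, -, hc⟩ := hS.exists_eigenvalue g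
    exact ⟨c • g • u, by rw [smul_mul', hc, mul_smul_comm, smul_mul_assoc c]⟩
  · intro a ha b hb
    obtain ⟨u, rfl⟩ := hS.ore.mem_spanX.1 hb
    rw [← mul_assoc]
    exact hS.ore.mem_divX.1 ((hS.ore.divX P).mul_mem_right _ _ ha)
  · exact fun h => hx (h (hS.ore.mem_spanX.2 ⟨1, by simp⟩))

theorem mem_of_mul_X_pow_mem {P : TwoSidedIdeal S} (hP : IsHPrime H P) (hx : x ∉ P) {s : S}
    (n : ℕ) (hs : s * x ^ n ∈ P) : s ∈ P := by
  induction n with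
  | zero => simpa using hs
  | succ n ih =>
    rw [pow_succ, ← mul_assoc] at hs
    exact ih (hS.mem_of_mul_X_mem hP hx hs)

/-- An `H`-prime ideal of `R[x; τ]` not containing `x` is homogeneous, and contains the coefficients
of its elements. -/
theorem coeff_mem_of_X_notMem {P : TwoSidedIdeal S} (hP : IsHPrime H P) (hx : x ∉ P) {s : S}
    (hs : s ∈ P) (n : ℕ) : ι (hS.ore.coeff n s) ∈ P := by
  obtain ⟨h₀, hτ, c, hc, hc'⟩ := hS.exists_h₀
  obtain ⟨F, hF⟩ := hS.ore.exists_forall_coeff_eq_zero s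
  induction F using Finset.induction_on generalizing s n with
  | empty => simp [hF, P.zero_mem]
  | insert m F hm ih =>
    -- `u` is `s` with `τ` applied to its coefficients, while `h₀ • s` has coefficients `c ^ n • τ
    -- (s_n)`. Hence `h₀ • s - c ^ m • u` loses degree `m` and has its other coefficients scaled by
    -- `c ^ n - c ^ m ≠ 0`, so the induction hypothesis applies.
    obtain ⟨u, hu⟩ := hS.ore.exists_X_mul_eq s
    have huP : u ∈ P := hS.mem_of_mul_X_mem hP hx (hu ▸ P.mul_mem_left _ _ hs)
    have hcu : ∀ n, hS.ore.coeff n u = τ (hS.ore.coeff n s) := fun n => by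
      rw [← hS.ore.coeff_mul_X, ← hu, hS.ore.coeff_X_mul]
    have hcv : ∀ n, hS.ore.coeff n (h₀ • s - (c : k) ^ m • u) =
        ((c : k) ^ n - (c : k) ^ m) • τ (hS.ore.coeff n s) := fun n => by
      rw [map_sub, hS.ore.coeff_algebra_smul, hS.coeff_smul hc, hcu, hτ, sub_smul]
    have hoff : ∀ n ≠ m, ι (hS.ore.coeff n s) ∈ P := by
      intro n hn
      have h1 := ih (s := h₀ • s - (c : k) ^ m • u)
        (P.sub_mem (hP.stable _ _ hs) (P.smul_mem' _ huP)) n (fun j hj => by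
          rw [hcv]
          by_cases hjm : j = m
          · simp [hjm]
          · rw [hF j (by simp [hjm, hj]), map_zero, smul_zero])
      rw [hcv, map_smul] at h1
      have hne : (c : k) ^ n - (c : k) ^ m ≠ 0 := by
        rw [sub_ne_zero]
        intro he
        exact hn (injective_pow_iff_not_isOfFinOrder.2 hc' (Units.ext (by simpa using he)))
      have h2 := P.mem_of_smul_mem hne h1
      rwa [← hτ, hS.equivariant, hP.stable.smul_mem_iff] at h2
    by_cases hn : n = m
    · subst hn
      -- The remaining coefficient: subtract all other terms, already in `P`, then cancel `x ^ n`.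
      have hsn : ι (hS.ore.coeff n s) * x ^ n ∈ P := by
        have h1 : s - ι (hS.ore.coeff n s) * x ^ n ∈ P := hS.ore.mem_of_coeff_mem fun j => by
          rw [map_sub, hS.ore.coeff_monomial]
          split_ifs with hj
          · rw [hj, sub_self, map_zero]
            exact P.zero_mem
          · rw [sub_zero]
            exact hoff j (Ne.symm hj)
        simpa using P.sub_mem hs h1
      exact hS.mem_of_mul_X_pow_mem hP hx n hsn
    · exact hoff n hn

theorem coeff_zero_mem {P : TwoSidedIdeal S} (hP : IsHPrime H P) {s : S} (hs : s ∈ P) :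
    ι (hS.ore.coeff 0 s) ∈ P := by
  by_cases hx : x ∈ P
  · obtain ⟨u, hu⟩ := hS.ore.exists_eq_coeff_zero_add_mul_X s
    rw [← sub_eq_iff_eq_add] at hu
    rw [← hu]
    exact P.sub_mem hs (P.mul_mem_left _ _ hx)
  · exact hS.coeff_mem_of_X_notMem hP hx hs 0

theorem le_iff {P Q : TwoSidedIdeal S} (hP : IsHPrime H P) :
    P ≤ Q ↔ P.comap ι ≤ Q.comap ι ∧ (x ∈ P → x ∈ Q) := by
  refine ⟨fun hPQ => ⟨TwoSidedIdeal.comap_le_comap _ hPQ, fun hx => hPQ hx⟩, ?_⟩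
  rintro ⟨hle, hx⟩ s hs
  have hle' : ∀ r, ι r ∈ P → ι r ∈ Q := fun r hr =>
    (TwoSidedIdeal.mem_comap _).1 (hle ((TwoSidedIdeal.mem_comap _).2 hr))
  -- If `x ∈ Q`, only constant coefficients matter; otherwise `x ∉ P` too, and `P` contains all
  -- coefficients.
  by_cases hxQ : x ∈ Q
  · obtain ⟨u, hu⟩ := hS.ore.exists_eq_coeff_zero_add_mul_X s
    rw [hu]
    exact Q.add_mem (hle' _ (hS.coeff_zero_mem hP hs)) (Q.mul_mem_left _ _ hxQ)
  · exact hS.ore.mem_of_coeff_mem fun n =>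
      hle' _ (hS.coeff_mem_of_X_notMem hP (fun h => hxQ (hx h)) hs n)

/-- `Spec_H R[x; τ]` is the product of `Spec_H R` with a two-element chain: an `H`-prime ideal is
determined by its intersection with `R` and by whether it contains `x`. -/
theorem nonempty_hSpec_orderIso_prod : Nonempty (HSpec H S ≃o HSpec H R × Prop) := by
  let f : HSpec H S → HSpec H R × Prop := fun P =>
    (⟨P.1.comap ι, hS.isHPrime_comap P.2⟩, x ∈ P.1)
  have hf : ∀ P Q, f P ≤ f Q ↔ P ≤ Q := fun P Q => (hS.le_iff P.2).symm
  refine ⟨⟨Equiv.ofBijective f ⟨?_, ?_⟩, fun {p q} => hf p q⟩⟩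
  · intro p q hpq
    exact le_antisymm ((hf _ _).1 hpq.le) ((hf _ _).1 hpq.ge)
  · rintro ⟨⟨I, hI⟩, b⟩
    have hcp := hS.completely_prime I hI
    have h1 := TwoSidedIdeal.ne_top_iff_one_notMem.1 hI.ne_top
    by_cases hb : b
    -- The prime `I + Sx`.
    · refine ⟨⟨_, (hS.ore.isCompletelyPrime_comap_constantCoeff hcp).isHPrime
        (hS.isHStable_comap_constantCoeff hI.stable)⟩, Prod.ext (Subtype.ext ?_) ?_⟩
      · ext r
        change r ∈ TwoSidedIdeal.comap ι _ ↔ r ∈ I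
        rw [TwoSidedIdeal.mem_comap, hS.ore.mem_comap_constantCoeff, hS.ore.coeff_ι, if_pos rfl]
      · refine propext ⟨fun _ => hb, fun _ => ?_⟩
        change x ∈ TwoSidedIdeal.comap _ I
        rw [hS.ore.mem_comap_constantCoeff, hS.ore.coeff_X, if_neg zero_ne_one]
        exact I.zero_mem
    -- The prime `I[x; τ]`, which omits `x` because `1 ∉ I`.
    · refine ⟨⟨_, (hS.ore.isCompletelyPrime_extend (hS.τ_mem_iff hI.stable) hcp).isHPrime
        (hS.isHStable_extend hI.stable)⟩, Prod.ext (Subtype.ext ?_) ?_⟩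
      · ext r
        change r ∈ TwoSidedIdeal.comap ι _ ↔ r ∈ I
        rw [TwoSidedIdeal.mem_comap, hS.ore.mem_extend]
        refine ⟨fun h => by simpa [hS.ore.coeff_ι] using h 0, fun hr n => ?_⟩
        rw [hS.ore.coeff_ι]
        split_ifs
        · exact hr
        · exact I.zero_mem
      · refine propext ⟨fun h => absurd ?_ h1, fun h => absurd h hb⟩
        replace h := (hS.ore.mem_extend (hI := fun r hr => (hS.τ_mem_iff hI.stable r).2 hr)).1 h
        simpa [hS.ore.coeff_X] using h 1

end IsCauchonExtension

theorem mainTheorem12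
    {B W : Type*} [Group W] {M : CoxeterMatrix B} (cs : CoxeterSystem M W)
    (i : B) (w : W) (hi : ¬ BruhatLE cs (cs.simple i) w)
    {k : Type*} [Field k] (q : kˣ) (H : Type*) [CommGroup H]
    {R S : Type*} [Ring R] [Algebra k R] [Ring S] [Algebra k S]
    [MulSemiringAction H R] [SMulCommClass H k R] [MulSemiringAction H S] [SMulCommClass H k S]
    (ι : R →ₐ[k] S) (x : S) (τ : R ≃ₐ[k] R)
    (hS : IsCauchonExtension q H ι x τ 0)
    (hR : Nonempty (BruhatInterval cs w ≃o HSpec H R)) :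
    Nonempty (BruhatInterval cs (w * cs.simple i) ≃o HSpec H S) := by
  obtain ⟨e⟩ := hR
  obtain ⟨b⟩ := nonempty_bruhatInterval_prod_orderIso hi
  obtain ⟨p⟩ := hS.nonempty_hSpec_orderIso_prod
  let e' : BruhatInterval cs w × Prop ≃o HSpec H R × Prop :=
    ⟨e.toEquiv.prodCongr (Equiv.refl Prop), fun {a b} => and_congr_left' (e.le_iff_le)⟩
  exact ⟨b.symm.trans (e'.trans p.symm)⟩
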